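/- Let $s$ be a spin, i.e. $2s$ is a positive integer, and let $m,n$ be integers with $2\le m\le n\le 2s$. Consider the real $(n+1)\times(n+1)$ matrices, with rows and columns indexed by $k,k'=0,1,\dots,n$, $$A^{(s,n)}_{kk'}=(-1)^{2s-n}\sqrt{(4s-2k+1)(4s-2k'+1)}\begin{Bmatrix} s & s & 2s-k\\ s & 3s-n & 2s-k'\end{Bmatrix},\qquad (D_0^{(n)})_{kk'}=(-1)^k\delta_{kk'},\qquad (\pi^{(m,n)})_{kk'}=\delta_{km}\delta_{k'm},$$ where the braces denote the $6$-$j$ symbol of $sl_2$, and put $\hat D_0^{(n)}=A^{(s,n)}D_0^{(n)}A^{(s,n)}$, $\hat\pi^{(m,n)}=A^{(s,n)}\pi^{(m,n)}A^{(s,n)}$ and $$\mathbf G^{(m,n)}=\pi^{(m,n)}-\hat\pi^{(m,n)},\qquad \mathbf H^{(m,n)}=\pi^{(m,n)}\hat D_0^{(n)}-D_0^{(n)}\hat\pi^{(m,n)},\qquad \tilde{\mathbf H}^{(m,n)}=\hat D_0^{(n)}\pi^{(m,n)}-\hat\pi^{(m,n)}D_0^{(n)}.$$ Then: (i) $\tilde{\mathbf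 H}^{(m,n)}=\mathbf H^{(m,n)}$ if and only if $m=3$ and $n=4$; (ii) there is a scalar $\beta$ with $\mathbf H^{(m,n)}+\tilde{\mathbf H}^{(m,n)}=\beta\,\mathbf G^{(m,n)}$ if and only if $m=3$ and $n=4$; (iii) for $m=3$, $n=4$ (and every spin $s\ge 2$) the relation in (ii) holds in the form $\mathbf H^{(3,4)}+\tilde{\mathbf H}^{(3,4)}=2\,\mathbf G^{(3,4)}$. -/

import Mathlib

noncomputable section

namespace ReducedYB

/-- Triangle condition for three spins `a/2`, `b/2`, `c/2` (the arguments are the doubled spins):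
the sum of the spins is an integer and each spin is at most the sum of the other two. -/
abbrev Triad (a b c : ℕ) : Prop :=
  Even (a + b + c) ∧ a ≤ b + c ∧ b ≤ a + c ∧ c ≤ a + b

/-- The triangle coefficient
`Δ(j₁ j₂ j₃) = √((j₁+j₂-j₃)! (j₁-j₂+j₃)! (-j₁+j₂+j₃)! / (j₁+j₂+j₃+1)!)`,
as a function of the doubled spins `a = 2 j₁`, `b = 2 j₂`, `c = 2 j₃`. It is only used when
`Triad a b c` holds, so that neither the subtractions nor the divisions by two truncate. -/
def triangleCoeff (a b c : ℕ) : ℝ :=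
  Real.sqrt
    ((((a + b - c) / 2).factorial * ((a + c - b) / 2).factorial * ((b + c - a) / 2).factorial : ℝ)
      / (((a + b + c) / 2 + 1).factorial : ℝ))

/-- The `6-j` symbol of `sl₂`, `{j₁ j₂ j₃; j₄ j₅ j₆}`, given by the Racah formula, as a function of
the doubled spins `aᵢ = 2 jᵢ`. The sum runs over all `l` for which every factorial has a
nonnegative argument. The symbol vanishes unless the four triads
`(j₁ j₂ j₃)`, `(j₁ j₅ j₆)`, `(j₄ j₂ j₆)`, `(j₄ j₅ j₃)` satisfy the triangle condition. -/
def sixJ (a₁ a₂ a₃ a₄ a₅ a₆ : ℕ) : ℝ :=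
  if Triad a₁ a₂ a₃ ∧ Triad a₁ a₅ a₆ ∧ Triad a₄ a₂ a₆ ∧ Triad a₄ a₅ a₃ then
    triangleCoeff a₁ a₂ a₃ * triangleCoeff a₁ a₅ a₆ * triangleCoeff a₄ a₂ a₆ *
        triangleCoeff a₄ a₅ a₃ *
      ∑ l ∈ Finset.Icc
          (max (max ((a₁ + a₂ + a₃) / 2) ((a₁ + a₅ + a₆) / 2))
            (max ((a₄ + a₂ + a₆) / 2) ((a₄ + a₅ + a₃) / 2)))
          (min ((a₁ + a₂ + a₄ + a₅) / 2)
            (min ((a₂ + a₃ + a₅ + a₆) / 2) ((a₃ + a₁ + a₆ + a₄) / 2))),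
        (-1 : ℝ) ^ l * ((l + 1).factorial : ℝ) /
          (((l - (a₁ + a₂ + a₃) / 2).factorial : ℝ) *
            ((l - (a₁ + a₅ + a₆) / 2).factorial : ℝ) *
            ((l - (a₄ + a₂ + a₆) / 2).factorial : ℝ) *
            ((l - (a₄ + a₅ + a₃) / 2).factorial : ℝ) *
            (((a₁ + a₂ + a₄ + a₅) / 2 - l).factorial : ℝ) *
            (((a₂ + a₃ + a₅ + a₆) / 2 - l).factorial : ℝ) *
            (((a₃ + a₁ + a₆ + a₄) / 2 - l).factorial : ℝ))
  else 0

/-- The matrix `A^{(s,n)}` for a spin `s = N/2` and a level `n ≤ 2s = N`, with rows and columns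
indexed by `k, k' = 0, …, n`:
`A_{kk'} = (-1)^{2s-n} √((4s-2k+1)(4s-2k'+1)) {s, s, 2s-k; s, 3s-n, 2s-k'}`. -/
def matA (N n : ℕ) : Matrix (Fin (n + 1)) (Fin (n + 1)) ℝ :=
  Matrix.of fun k k' =>
    (-1 : ℝ) ^ (N - n) *
      Real.sqrt ((2 * (N : ℝ) - 2 * ((k : ℕ) : ℝ) + 1) * (2 * (N : ℝ) - 2 * ((k' : ℕ) : ℝ) + 1)) *
      sixJ N N (2 * N - 2 * (k : ℕ)) N (3 * N - 2 * n) (2 * N - 2 * (k' : ℕ))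

/-- The diagonal matrix `D₀^{(n)}` with diagonal entries `(-1)^k`, `k = 0, …, n`. -/
def matD (n : ℕ) : Matrix (Fin (n + 1)) (Fin (n + 1)) ℝ :=
  Matrix.diagonal fun k => (-1 : ℝ) ^ (k : ℕ)

/-- The matrix `D̂₀^{(n)} = A D₀ A`. -/
def matDhat (N n : ℕ) : Matrix (Fin (n + 1)) (Fin (n + 1)) ℝ :=
  matA N n * matD n * matA N n

/-- The matrix `π^{(m,n)}` with entries `δ_{km} δ_{k'm}`, `k, k' = 0, …, n`. -/
def matPi (m n : ℕ) : Matrix (Fin (n + 1)) (Fin (n + 1)) ℝ :=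
  Matrix.of fun k k' => if (k : ℕ) = m ∧ (k' : ℕ) = m then 1 else 0

/-- The matrix `π̂^{(m,n)} = A π A`. -/
def matPihat (N m n : ℕ) : Matrix (Fin (n + 1)) (Fin (n + 1)) ℝ :=
  matA N n * matPi m n * matA N n

/-- `G^{(m,n)} = π - π̂`. -/
def matG (N m n : ℕ) : Matrix (Fin (n + 1)) (Fin (n + 1)) ℝ :=
  matPi m n - matPihat N m n

/-- `H^{(m,n)} = π D̂₀ - D₀ π̂`. -/
def matH (N m n : ℕ) : Matrix (Fin (n + 1)) (Fin (n + 1)) ℝ :=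
  matPi m n * matDhat N n - matD n * matPihat N m n

/-- `H̃^{(m,n)} = D̂₀ π - π̂ D₀`. -/
def matHtilde (N m n : ℕ) : Matrix (Fin (n + 1)) (Fin (n + 1)) ℝ :=
  matDhat N n * matPi m n - matPihat N m n * matD n

end ReducedYB

end

/-!
Write `e` for the `m`-th basis vector and `v = A e` for the `m`-th column of the symmetric matrix
`A`. Then `π = e eᵀ`, `π̂ = v vᵀ`, and `H̃ = Hᵀ`. Outside row and column `m` the matrices `H`, `H̃`
and `G` have the entries `-(-1)ᵏ vₖ vₗ`, `-(-1)ˡ vₖ vₗ` and `-vₖ vₗ`. The entry `v₀` is never zero,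
being a one-term Racah sum. Hence `H̃ = H` forces `vₖ = 0` for every odd `k ≠ m`, and so does
`H + H̃ = β G`, because its `(0, 0)` entry gives `β = 2`.

Up to positive factors depending on `k` alone and on `m` alone, `vₖ` is a Racah polynomial
`racahSum N n m k` (`matA_apply`), and the three-term recurrence of these polynomials at `k = 1, 2`
(`racahSum_two_rec`, `racahSum_three_rec`) shows that `v₁` and `v₃` do not vanish together. So
`n ≤ 2` or `m = 3`; the explicit value of `racahSum N n m 1` is a multiple of
`3nN - n² + n - 4mN + 2m² - 2m`, which does not vanish for `m = n = 2` and is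
`(n - 4)(3N - n - 3)` for `m = 3`, where it therefore vanishes only for `n = 4`
(`level_eq_four`).

Conversely, for `m = 3` and `n = 4` we have `v₁ = 0`, so that `D v = v - 2 v₃ e`. Together with
`A v = e` (`matA_four_sum`: the column of index `3` of `A` is a unit vector orthogonal to the other
columns, as is checked on the explicit rational functions of `N`) this gives
`D̂ e = A D v = e - 2 v₃ v`, and then `H = e (D̂ e)ᵀ - (D v) vᵀ = e eᵀ - v vᵀ = G`. Since `G` is
symmetric, `H̃ = H = G`.
-/

namespace ReducedYB

open Finset Matrix

/-! ### The `6-j` symbols as Racah polynomials -/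

/-- The Racah polynomial `₄F₃` proportional to the entry `A_{km}`; it equals `1` at `k = 0`.
The falling factorials make the summands outside the range of Racah's formula vanish, so that the
sum runs over `0 ≤ j ≤ k` for all `k` and `m`. -/
noncomputable def racahSum (N n m k : ℕ) : ℝ :=
  ∑ j ∈ range (k + 1), (-1 : ℝ) ^ j * (k.choose j : ℝ) * (m.descFactorial j : ℝ) *
    ((N - n + m).descFactorial j : ℝ) * ((N - n + k).descFactorial j : ℝ) *
    ((n - m).descFactorial (k - j) : ℝ) * ((N - m).descFactorial (k - j) : ℝ) /
    ((3 * N - n + 1).descFactorial j : ℝ)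

lemma descFactorial_cast_ne_zero {x j : ℕ} (h : j ≤ x) : (x.descFactorial j : ℝ) ≠ 0 := by
  simpa [Nat.descFactorial_eq_zero_iff_lt] using h

lemma factorial_sub_cast {x j : ℕ} (h : j ≤ x) :
    ((x - j).factorial : ℝ) = (x.factorial : ℝ) / (x.descFactorial j : ℝ) := by
  rw [eq_div_iff (descFactorial_cast_ne_zero h)]
  exact_mod_cast Nat.factorial_mul_descFactorial h

lemma racah_term {N n m k j : ℕ} (hm : m ≤ n) (hn : n ≤ N)
    (hjk : j ≤ k) (hjm : j ≤ m) (hj : k - j ≤ n - m) :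
    ((3 * N - n + 1 - j).factorial : ℝ) /
      (((N - n + k - j).factorial : ℝ) * ((m - j).factorial : ℝ) *
        ((N - n + m - j).factorial : ℝ) * ((k - j).factorial : ℝ) * (j.factorial : ℝ) *
        ((N - m - (k - j)).factorial : ℝ) * ((n - m - (k - j)).factorial : ℝ)) =
    ((3 * N - n + 1).factorial : ℝ) /
      ((k.factorial : ℝ) * ((N - n + k).factorial : ℝ) * (m.factorial : ℝ) *
        ((n - m).factorial : ℝ) * ((N - m).factorial : ℝ) * ((N - n + m).factorial : ℝ)) *
    ((k.choose j : ℝ) * (m.descFactorial j : ℝ) *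
    ((N - n + m).descFactorial j : ℝ) * ((N - n + k).descFactorial j : ℝ) *
    ((n - m).descFactorial (k - j) : ℝ) * ((N - m).descFactorial (k - j) : ℝ) /
    ((3 * N - n + 1).descFactorial j : ℝ)) := by
  have h1 : j ≤ 3 * N - n + 1 := by omega
  have h2 : j ≤ N - n + k := by omega
  have h3 : j ≤ N - n + m := by omega
  have h4 : k - j ≤ N - m := by omega
  rw [← Nat.choose_mul_factorial_mul_factorial hjk, factorial_sub_cast h1, factorial_sub_cast h2,
    factorial_sub_cast h3, factorial_sub_cast h4, factorial_sub_cast hj, factorial_sub_cast hjm]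
  have := descFactorial_cast_ne_zero h1
  have := descFactorial_cast_ne_zero h2
  have := descFactorial_cast_ne_zero h3
  have := descFactorial_cast_ne_zero h4
  have := descFactorial_cast_ne_zero hj
  have := descFactorial_cast_ne_zero hjm
  have hc : (k.choose j : ℝ) ≠ 0 := by exact_mod_cast (Nat.choose_pos hjk).ne'
  have hf : ∀ x : ℕ, (x.factorial : ℝ) ≠ 0 := fun x => by exact_mod_cast x.factorial_ne_zero
  have := hf j
  have := hf (k - j)
  have := hf m
  have := hf (n - m)
  have := hf (N - m)
  have := hf (N - n + m)
  have := hf (N - n + k)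
  push_cast
  field_simp

/-- Racah's sum for the symbols that occur in `A`, after the substitution `l = 3N - n - j`. -/
lemma sum_Icc_eq_racahSum {N n m k : ℕ} (hm : m ≤ n) (hn : n ≤ N) (hk : k ≤ n) :
    ∑ l ∈ Icc (max (max (2 * N - k) (3 * N - n - m)) (max (2 * N - m) (3 * N - n - k)))
        (min (3 * N - n) (min (4 * N - n - k - m) (3 * N - k - m))),
      (-1 : ℝ) ^ l * ((l + 1).factorial : ℝ) /
        (((l - (2 * N - k)).factorial : ℝ) * ((l - (3 * N - n - m)).factorial : ℝ) *
          ((l - (2 * N - m)).factorial : ℝ) * ((l - (3 * N - n - k)).factorial : ℝ) *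
          ((3 * N - n - l).factorial : ℝ) * ((4 * N - n - k - m - l).factorial : ℝ) *
          ((3 * N - k - m - l).factorial : ℝ)) =
      (-1 : ℝ) ^ (N - n) * (((3 * N - n + 1).factorial : ℝ) /
      ((k.factorial : ℝ) * ((N - n + k).factorial : ℝ) * (m.factorial : ℝ) *
        ((n - m).factorial : ℝ) * ((N - m).factorial : ℝ) * ((N - n + m).factorial : ℝ)) *
        racahSum N n m k) := by
  rw [racahSum, Finset.mul_sum, Finset.mul_sum]
  have hmem : ∀ l, l ∈ Icc (max (max (2 * N - k) (3 * N - n - m))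
      (max (2 * N - m) (3 * N - n - k))) (min (3 * N - n) (min (4 * N - n - k - m)
      (3 * N - k - m))) ↔ ∃ j, l + n + j = 3 * N ∧ j ≤ k ∧ j ≤ m ∧ k + m ≤ n + j := by
    intro l
    simp only [mem_Icc, max_le_iff, le_min_iff]
    constructor
    · rintro h
      exact ⟨3 * N - n - l, by omega, by omega, by omega, by omega⟩
    · rintro ⟨j, h1, h2, h3, h4⟩
      omega
  refine Finset.sum_of_injOn (fun l => 3 * N - n - l) ?_ ?_ ?_ ?_
  · intro l hl l' hl' h
    obtain ⟨j, h1, -⟩ := (hmem l).1 hl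
    obtain ⟨j', h1', -⟩ := (hmem l').1 hl'
    simp only at h
    omega
  · intro l hl
    obtain ⟨j, h1, h2, -⟩ := (hmem l).1 hl
    simp only [coe_range, Set.mem_Iio]
    omega
  · intro j hj hj'
    have hjk : j ≤ k := by simpa [Nat.lt_succ_iff] using hj
    have hout : m < j ∨ n - m < k - j := by
      by_contra! hcon
      exact hj' ⟨3 * N - n - j, (hmem _).2 ⟨j, by omega, hjk, by omega, by omega⟩,
        by simp only; omega⟩
    rcases hout with h | h <;> simp [Nat.descFactorial_of_lt h]
  · intro l hl
    obtain ⟨j, h1, h2, h3, h4⟩ := (hmem l).1 hl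
    have hj2 : k - j ≤ n - m := by omega
    have f0 : 3 * N - n - l = j := by omega
    have hs : (-1 : ℝ) ^ l = (-1) ^ (N - n) * (-1) ^ j := by
      have : l + 2 * j = (N - n) + j + 2 * N := by omega
      have h2 := congrArg (fun x => (-1 : ℝ) ^ x) this
      simp only [pow_add, pow_mul] at h2
      simpa using h2
    have f1 : l + 1 = 3 * N - n + 1 - j := by omega
    have f2 : l - (2 * N - k) = N - n + k - j := by omega
    have f3 : l - (3 * N - n - m) = m - j := by omega
    have f4 : l - (2 * N - m) = N - n + m - j := by omega
    have f5 : l - (3 * N - n - k) = k - j := by omega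
    have f6 : 4 * N - n - k - m - l = N - m - (k - j) := by omega
    have f7 : 3 * N - k - m - l = n - m - (k - j) := by omega
    simp only [f0]
    rw [f1, f2, f3, f4, f5, f6, f7, hs, mul_div_assoc, racah_term hm hn h2 h3 hj2]
    ring

lemma sixJ_eq_racahSum {N n m k : ℕ} (hm : m ≤ n) (hn : n ≤ N) (hk : k ≤ n) :
    sixJ N N (2 * N - 2 * k) N (3 * N - 2 * n) (2 * N - 2 * m) =
    triangleCoeff N N (2 * N - 2 * k) * triangleCoeff N (3 * N - 2 * n) (2 * N - 2 * m) *
      triangleCoeff N N (2 * N - 2 * m) * triangleCoeff N (3 * N - 2 * n) (2 * N - 2 * k) *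
      ((-1 : ℝ) ^ (N - n) * (((3 * N - n + 1).factorial : ℝ) /
      ((k.factorial : ℝ) * ((N - n + k).factorial : ℝ) * (m.factorial : ℝ) *
        ((n - m).factorial : ℝ) * ((N - m).factorial : ℝ) * ((N - n + m).factorial : ℝ)) *
        racahSum N n m k)) := by
  rw [← sum_Icc_eq_racahSum hm hn hk]
  obtain ⟨x, hx⟩ : ∃ x, x = 2 * N - 2 * k := ⟨_, rfl⟩
  obtain ⟨y, hy⟩ : ∃ y, y = 3 * N - 2 * n := ⟨_, rfl⟩
  obtain ⟨z, hz⟩ : ∃ z, z = 2 * N - 2 * m := ⟨_, rfl⟩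
  rw [← hx, ← hy, ← hz]
  have hx' : x + 2 * k = 2 * N := by omega
  have hy' : y + 2 * n = 3 * N := by omega
  have hz' : z + 2 * m = 2 * N := by omega
  clear hx hy hz
  have hT : Triad N N x ∧ Triad N y z ∧ Triad N N z ∧ Triad N y x := by
    refine ⟨⟨?_, ?_, ?_, ?_⟩, ⟨?_, ?_, ?_, ?_⟩, ⟨?_, ?_, ?_, ?_⟩, ⟨?_, ?_, ?_, ?_⟩⟩
    all_goals try rw [Nat.even_iff]
    all_goals omega
  have e1 : (N + N + x) / 2 = 2 * N - k := by omega
  have e2 : (N + y + z) / 2 = 3 * N - n - m := by omega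
  have e3 : (N + N + z) / 2 = 2 * N - m := by omega
  have e4 : (N + y + x) / 2 = 3 * N - n - k := by omega
  have e5 : (N + N + N + y) / 2 = 3 * N - n := by omega
  have e6 : (N + x + y + z) / 2 = 4 * N - n - k - m := by omega
  have e7 : (x + N + z + N) / 2 = 3 * N - k - m := by omega
  rw [sixJ, if_pos hT, e1, e2, e3, e4, e5, e6, e7]

/-- The factor of `A_{km}` that comes from the square roots and the triangle coefficients involving
the index `k`; the same factor occurs for `m`. -/
noncomputable def legCoeff (N n k : ℕ) : ℝ :=
  Real.sqrt (2 * (N : ℝ) - 2 * (k : ℝ) + 1) * triangleCoeff N N (2 * N - 2 * k) *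
    triangleCoeff N (3 * N - 2 * n) (2 * N - 2 * k)

lemma triangleCoeff_pos (a b c : ℕ) : 0 < triangleCoeff a b c := by
  unfold triangleCoeff
  positivity

lemma legCoeff_pos {N n k : ℕ} (hk : k ≤ N) : 0 < legCoeff N n k := by
  have : (k : ℝ) ≤ N := by exact_mod_cast hk
  have h : 0 < Real.sqrt (2 * (N : ℝ) - 2 * (k : ℝ) + 1) := Real.sqrt_pos.2 (by linarith)
  have := triangleCoeff_pos
  exact mul_pos (mul_pos h (this _ _ _)) (this _ _ _)

/-- The positive factor of `A_{km}` depending on the row index `k`, relative to `racahSum`. -/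
noncomputable def rowCoeff (N n k : ℕ) : ℝ :=
  legCoeff N n k / ((k.factorial : ℝ) * ((N - n + k).factorial : ℝ))

/-- The positive factor of `A_{km}` depending on the column index `m`, relative to `racahSum`. -/
noncomputable def colCoeff (N n m : ℕ) : ℝ :=
  legCoeff N n m * ((3 * N - n + 1).factorial : ℝ) / ((m.factorial : ℝ) *
        ((n - m).factorial : ℝ) * ((N - m).factorial : ℝ) * ((N - n + m).factorial : ℝ))

lemma rowCoeff_pos {N n k : ℕ} (hk : k ≤ N) : 0 < rowCoeff N n k := by
  have := legCoeff_pos (n := n) hk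
  unfold rowCoeff
  positivity

lemma colCoeff_pos {N n k : ℕ} (hk : k ≤ N) : 0 < colCoeff N n k := by
  have := legCoeff_pos (n := n) hk
  unfold colCoeff
  positivity

lemma matA_apply {N n : ℕ} (hn : n ≤ N) (k m : Fin (n + 1)) :
    matA N n k m = rowCoeff N n k * colCoeff N n m * racahSum N n m k := by
  have hk : (k : ℕ) ≤ n := Nat.lt_succ_iff.1 k.2
  have hm : (m : ℕ) ≤ n := Nat.lt_succ_iff.1 m.2
  have hs : (-1 : ℝ) ^ (N - n) * (-1 : ℝ) ^ (N - n) = 1 := by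
    rw [← mul_pow]; simp
  have hk' : ((k : ℕ) : ℝ) ≤ N := by exact_mod_cast hk.trans hn
  rw [matA, Matrix.of_apply, sixJ_eq_racahSum hm hn hk, Real.sqrt_mul (by linarith)]
  unfold rowCoeff colCoeff legCoeff
  linear_combination (Real.sqrt (2 * (N : ℝ) - 2 * ((k : ℕ) : ℝ) + 1)) *
    (Real.sqrt (2 * (N : ℝ) - 2 * ((m : ℕ) : ℝ) + 1)) *
    (triangleCoeff N N (2 * N - 2 * k) * triangleCoeff N (3 * N - 2 * n) (2 * N - 2 * m) *
      triangleCoeff N N (2 * N - 2 * m) * triangleCoeff N (3 * N - 2 * n) (2 * N - 2 * k)) *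
    ((((3 * N - n + 1).factorial : ℝ) /
      (((k : ℕ).factorial : ℝ) * ((N - n + k).factorial : ℝ) * ((m : ℕ).factorial : ℝ) *
        ((n - m).factorial : ℝ) * ((N - m).factorial : ℝ) * ((N - n + m).factorial : ℝ)) *
        racahSum N n m k)) * hs

lemma sixJ_swap (a b c d : ℕ) : sixJ a a c a b d = sixJ a a d a b c := by
  unfold sixJ
  refine if_congr (by tauto) ?_ rfl
  have h1 : a + c + b + d = a + d + b + c := by omega
  have h2 : c + a + d + a = d + a + c + a := by omega
  rw [h1, h2, max_comm (max ((a + a + c) / 2) _)]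
  congr 1
  · ring
  · refine Finset.sum_congr ?_ fun l _ => ?_
    · rfl
    · congr 1
      ring

lemma matA_symm (N n : ℕ) (k m : Fin (n + 1)) : matA N n k m = matA N n m k := by
  unfold matA
  rw [Matrix.of_apply, Matrix.of_apply, sixJ_swap, mul_comm (2 * (N : ℝ) - _ + 1)]

lemma matA_zero_ne_zero {N n : ℕ} (hn : n ≤ N) (m : Fin (n + 1)) : matA N n 0 m ≠ 0 := by
  rw [matA_apply hn]
  have h := (rowCoeff_pos (n := n) (Nat.zero_le N)).ne'
  have h' := (colCoeff_pos (n := n) ((Nat.lt_succ_iff.1 m.2).trans hn)).ne'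
  simp [racahSum, h, h']

lemma matA_eq_zero_iff {N n : ℕ} (hn : n ≤ N) (k m : Fin (n + 1)) :
    matA N n k m = 0 ↔ racahSum N n m k = 0 := by
  have h := (rowCoeff_pos (n := n) ((Nat.lt_succ_iff.1 k.2).trans hn)).ne'
  have h' := (colCoeff_pos (n := n) ((Nat.lt_succ_iff.1 m.2).trans hn)).ne'
  rw [matA_apply hn]
  simp [h, h']

/-! ### The three-term recurrence and the zeros of the first column entries -/

/-- No hypothesis `j ≤ x` is needed: for `x < j` both sides have a zero factor. -/
lemma descFactorial_cast_eq_prod (x j : ℕ) :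
    (x.descFactorial j : ℝ) = ∏ i ∈ range j, ((x : ℝ) - i) := by
  induction j with
  | zero => simp
  | succ j ih =>
    rw [Nat.descFactorial_succ, prod_range_succ, ← ih]
    rcases le_or_gt j x with h | h
    · push_cast [Nat.cast_sub h]; ring
    · simp [Nat.descFactorial_of_lt h]

lemma racahSum_eq_prod {N n m : ℕ} (hm : m ≤ n) (hn : n ≤ N) (k : ℕ) :
    racahSum N n m k = ∑ j ∈ range (k + 1), (-1 : ℝ) ^ j * (k.choose j : ℝ) *
      (∏ i ∈ range j, ((m : ℝ) - i)) * (∏ i ∈ range j, ((N : ℝ) - n + m - i)) *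
      (∏ i ∈ range j, ((N : ℝ) - n + k - i)) * (∏ i ∈ range (k - j), ((n : ℝ) - m - i)) *
      (∏ i ∈ range (k - j), ((N : ℝ) - m - i)) / ∏ i ∈ range j, (3 * (N : ℝ) - n + 1 - i) := by
  have h3 : n ≤ 3 * N := by omega
  simp only [racahSum, descFactorial_cast_eq_prod, Nat.cast_add, Nat.cast_sub hm, Nat.cast_sub hn,
    Nat.cast_sub h3, Nat.cast_sub (hm.trans hn), Nat.cast_mul, Nat.cast_ofNat, Nat.cast_one]

lemma racahSum_one {N n m : ℕ} (hm : m ≤ n) (hn : n ≤ N) :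
    (3 * (N : ℝ) - n + 1) * racahSum N n m 1 =
      N * (3 * n * N - n ^ 2 + n - 4 * m * N + 2 * m ^ 2 - 2 * m) := by
  have hn' : (n : ℝ) ≤ N := by exact_mod_cast hn
  have : 3 * (N : ℝ) - n + 1 ≠ 0 := by
    have : (0 : ℝ) ≤ N := Nat.cast_nonneg N
    linarith
  rw [racahSum_eq_prod hm hn]
  simp [sum_range_succ]
  field_simp
  ring

/-- The three-term recurrence at `k = 1`, with the denominators `N - 1` and `2N - 1` cleared. The
spectral parameter, which is affine in `racahSum N n m 1`, has been expressed through it. -/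
lemma racahSum_two_rec {N n m : ℕ} (hm : m ≤ n) (hn : n ≤ N) (hN : 1 ≤ N) :
    2 * N ^ 2 * (3 * (N : ℝ) - n) * racahSum N n m 2 +
      (N - n + 1) * n * (2 * N - n) * N ^ 2 * (N - 1) =
    ((3 * (N : ℝ) - n + 1) * racahSum N n m 1 - 2 * N ^ 2) * (N - 1) * (2 * N - 1) *
      racahSum N n m 1 := by
  have hn' : (n : ℝ) ≤ N := by exact_mod_cast hn
  have hN' : (1 : ℝ) ≤ N := by exact_mod_cast hN
  have h1 : 3 * (N : ℝ) - n + 1 ≠ 0 := by linarith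
  have h2 : 3 * (N : ℝ) - n + 1 - 1 ≠ 0 := by linarith
  rw [racahSum_eq_prod hm hn, racahSum_eq_prod hm hn]
  -- With `T` in place of `n` the denominators become `T`, `T - 1`, `T - 2`.
  obtain ⟨T, hT⟩ : ∃ T, T = 3 * (N : ℝ) - n + 1 := ⟨_, rfl⟩
  obtain hn'' : (n : ℝ) = 3 * N + 1 - T := by linarith
  simp only [← hT] at *
  simp [sum_range_succ, prod_range_succ]
  rw [hn'']
  field_simp
  ring

/-- The three-term recurrence at `k = 2`, with the denominators `N - 2` and `2N - 3` cleared. -/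
lemma racahSum_three_rec {N n m : ℕ} (hm : m ≤ n) (hn : n ≤ N) (hN : 1 ≤ N) :
    N * (2 * N - 1) * (3 * (N : ℝ) - n - 1) * racahSum N n m 3 +
      2 * N * (N - n + 2) * (n - 1) * (2 * N - n - 1) * (N - 1) * (N - 2) * racahSum N n m 1 =
    ((3 * (N : ℝ) - n + 1) * racahSum N n m 1 - 2 * N * (2 * N - 1)) * (N - 2) * (2 * N - 3) *
      racahSum N n m 2 := by
  have hn' : (n : ℝ) ≤ N := by exact_mod_cast hn
  have hN' : (1 : ℝ) ≤ N := by exact_mod_cast hN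
  have h1 : 3 * (N : ℝ) - n + 1 ≠ 0 := by linarith
  have h2 : 3 * (N : ℝ) - n + 1 - 1 ≠ 0 := by linarith
  have h3 : 3 * (N : ℝ) - n + 1 - 2 ≠ 0 := by linarith
  rw [racahSum_eq_prod hm hn, racahSum_eq_prod hm hn, racahSum_eq_prod hm hn]
  -- With `T` in place of `n` the denominators become `T`, `T - 1`, `T - 2`.
  obtain ⟨T, hT⟩ : ∃ T, T = 3 * (N : ℝ) - n + 1 := ⟨_, rfl⟩
  obtain hn'' : (n : ℝ) = 3 * N + 1 - T := by linarith
  simp only [← hT] at *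
  simp [sum_range_succ, prod_range_succ]
  rw [hn'']
  field_simp
  ring

/-- If `racahSum N n m 1` and `racahSum N n m 3` vanished, the recurrence at `k = 2` would give
`racahSum N n m 2 = 0`, and the one at `k = 1` would then contradict `racahSum N n m 0 = 1`. -/
lemma racahSum_three_ne_zero {N n m : ℕ} (hm : m ≤ n) (hn : n ≤ N) (h3 : 3 ≤ n)
    (h : racahSum N n m 1 = 0) : racahSum N n m 3 ≠ 0 := by
  intro h0
  have hn' : (n : ℝ) ≤ N := by exact_mod_cast hn
  have h3' : (3 : ℝ) ≤ n := by exact_mod_cast h3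
  have e2 := racahSum_two_rec hm hn (by omega)
  have e3 := racahSum_three_rec hm hn (by omega)
  rw [h, h0] at e3
  rw [h] at e2
  have hp : (2 * (N : ℝ) * (2 * N - 1)) * (N - 2) * (2 * N - 3) ≠ 0 := by
    have a1 : 0 < 2 * (N : ℝ) - 1 := by linarith
    have a2 : 0 < (N : ℝ) - 2 := by linarith
    have a3 : 0 < 2 * (N : ℝ) - 3 := by linarith
    have a4 : 0 < (N : ℝ) := by linarith
    positivity
  have h2 : racahSum N n m 2 = 0 := by
    apply (mul_eq_zero.1 ?_).resolve_left hp
    linear_combination e3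
  rw [h2] at e2
  have a1 : 0 < (N : ℝ) - n + 1 := by linarith
  have a2 : 0 < 2 * (N : ℝ) - n := by linarith
  have a3 : 0 < (N : ℝ) - 1 := by linarith
  have a4 : 0 < (N : ℝ) := by linarith
  have a5 : 0 < (n : ℝ) := by linarith
  have : 0 < ((N : ℝ) - n + 1) * n * (2 * N - n) * N ^ 2 * (N - 1) := by positivity
  linarith

lemma level_eq_four {N n m : ℕ} (h2 : 2 ≤ m) (hm : m ≤ n) (hn : n ≤ N)
    (h1 : racahSum N n m 1 = 0) (h3 : 3 ≤ n → m ≠ 3 → racahSum N n m 3 = 0) :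
    m = 3 ∧ n = 4 := by
  have e := racahSum_one hm hn
  have hN : (N : ℝ) ≠ 0 := by
    have : N ≠ 0 := by omega
    exact_mod_cast this
  rw [h1, mul_zero, eq_comm, mul_eq_zero, or_iff_right hN] at e
  have hn' : (n : ℝ) ≤ N := by exact_mod_cast hn
  rcases le_or_gt 3 n with hn3 | hn3
  · have hm3 : m = 3 := by
      by_contra hne
      exact racahSum_three_ne_zero hm hn hn3 h1 (h3 hn3 hne)
    subst hm3
    refine ⟨rfl, ?_⟩
    have h3' : (3 : ℝ) ≤ n := by exact_mod_cast hn3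
    have : ((n : ℝ) - 4) * (3 * N - n - 3) = 0 := by
      push_cast at e
      linear_combination e
    rcases mul_eq_zero.1 this with h | h
    · have : (n : ℝ) = 4 := by linarith
      exact_mod_cast this
    · linarith
  · obtain rfl : n = 2 := by omega
    obtain rfl : m = 2 := by omega
    push_cast at e hn'
    linarith

/-! ### Orthogonality for level four -/

lemma colCoeff_sq {N n l : ℕ} (hl : l ≤ n) (hn : n ≤ N) :
    colCoeff N n l ^ 2 = (2 * (N : ℝ) - 2 * l + 1) * ((2 * N - n - l).factorial : ℝ) *
      ((3 * N - n + 1).factorial : ℝ) ^ 2 /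
      ((l.factorial : ℝ) * ((n - l).factorial : ℝ) * ((2 * N - l + 1).factorial : ℝ) *
        ((3 * N - n - l + 1).factorial : ℝ) * ((N - n + l).factorial : ℝ)) := by
  have hl' : (l : ℝ) ≤ N := by exact_mod_cast hl.trans hn
  have hf : ∀ x : ℕ, (x.factorial : ℝ) ≠ 0 := fun x => by exact_mod_cast x.factorial_ne_zero
  have e1 : (N + N - (2 * N - 2 * l)) / 2 = l := by omega
  have e2 : (N + (2 * N - 2 * l) - N) / 2 = N - l := by omega
  have e3 : (N + N + (2 * N - 2 * l)) / 2 = 2 * N - l := by omega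
  have e4 : (N + (3 * N - 2 * n) - (2 * N - 2 * l)) / 2 = N - n + l := by omega
  have e5 : (N + (2 * N - 2 * l) - (3 * N - 2 * n)) / 2 = n - l := by omega
  have e6 : (3 * N - 2 * n + (2 * N - 2 * l) - N) / 2 = 2 * N - n - l := by omega
  have e7 : (N + (3 * N - 2 * n) + (2 * N - 2 * l)) / 2 = 3 * N - n - l := by omega
  unfold colCoeff legCoeff triangleCoeff
  rw [e1, e2, e3, e4, e5, e6, e7, div_pow, mul_pow, mul_pow, mul_pow, Real.sq_sqrt (by linarith),
    Real.sq_sqrt (by positivity), Real.sq_sqrt (by positivity)]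
  have := hf l
  have := hf (n - l)
  have := hf (N - l)
  have := hf (N - n + l)
  have := hf (2 * N - l + 1)
  have := hf (3 * N - n - l + 1)
  field_simp

/-- The orthogonality weight of the Racah polynomials of level `n = 4` at `N = x + 4`, up to a
factor independent of `l` (see `colCoeff_sq_four`). -/
noncomputable def colWeight (x : ℝ) (l : ℕ) : ℝ :=
  (2 * x + 9 - 2 * l) * (∏ i ∈ range l, (3 * x + 9 - i)) * (∏ i ∈ range (4 - l), (x + 4 - i)) /
    ((l.factorial : ℝ) * ((4 - l).factorial : ℝ) * ∏ i ∈ range 5, (2 * x + 9 - l - i))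

lemma colCoeff_sq_four (t : ℕ) {l : ℕ} (hl : l ≤ 4) :
    colCoeff (t + 4) 4 l ^ 2 =
      ((3 * t + 9).factorial : ℝ) / ((t + 4).factorial : ℝ) * colWeight t l := by
  have hf : ∀ x : ℕ, (x.factorial : ℝ) ≠ 0 := fun x => by exact_mod_cast x.factorial_ne_zero
  have h1 : 2 * (t + 4) - 4 - l = 2 * t + 9 - l - 5 := by omega
  have h2 : 3 * (t + 4) - 4 + 1 = 3 * t + 9 := by omega
  have h3 : 2 * (t + 4) - l + 1 = 2 * t + 9 - l := by omega
  have h4 : 3 * (t + 4) - 4 - l + 1 = 3 * t + 9 - l := by omega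
  have h5 : t + 4 - 4 + l = t + 4 - (4 - l) := by omega
  have d1 := descFactorial_cast_ne_zero (show 5 ≤ 2 * t + 9 - l by omega)
  have d2 := descFactorial_cast_ne_zero (show l ≤ 3 * t + 9 by omega)
  have d3 := descFactorial_cast_ne_zero (show 4 - l ≤ t + 4 by omega)
  have e1 := descFactorial_cast_eq_prod (2 * t + 9 - l) 5
  have e2 := descFactorial_cast_eq_prod (3 * t + 9) l
  have e3 := descFactorial_cast_eq_prod (t + 4) (4 - l)
  rw [Nat.cast_sub (by omega)] at e1
  push_cast at e1 e2 e3
  rw [colCoeff_sq hl (by omega), h1, h2, h3, h4, h5, factorial_sub_cast (by omega),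
    factorial_sub_cast (show l ≤ 3 * t + 9 by omega),
    factorial_sub_cast (show 4 - l ≤ t + 4 by omega), colWeight, ← e1, ← e2, ← e3]
  have := hf l
  have := hf (4 - l)
  have := hf (2 * t + 9 - l)
  have := hf (3 * t + 9)
  have := hf (t + 4)
  push_cast
  field_simp
  ring

lemma racahSum_four (t : ℕ) {l : ℕ} (hl : l ≤ 4) (k : ℕ) :
    racahSum (t + 4) 4 l k = ∑ j ∈ range (k + 1), (-1 : ℝ) ^ j * (k.choose j : ℝ) *
      (∏ i ∈ range j, ((l : ℝ) - i)) * (∏ i ∈ range j, ((t : ℝ) + l - i)) *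
      (∏ i ∈ range j, ((t : ℝ) + k - i)) * (∏ i ∈ range (k - j), ((4 : ℝ) - l - i)) *
      (∏ i ∈ range (k - j), ((t : ℝ) + 4 - l - i)) / ∏ i ∈ range j, (3 * (t : ℝ) + 9 - i) := by
  rw [racahSum_eq_prod hl (by omega)]
  push_cast
  ring_nf

/-- The values that enter the column of index `3` of `A` for `n = 4`. The zero at `l = 1` is what
makes `m = 3`, `n = 4` exceptional. -/
lemma racahSum_four_three (t : ℕ) :
    racahSum (t + 4) 4 0 3 = 24 * (t + 4) * (t + 3) * (t + 2) ∧
    racahSum (t + 4) 4 1 3 = 0 ∧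
    racahSum (t + 4) 4 2 3 = -8 * (t + 2) ^ 2 * (t + 1) * (t + 3) / (3 * t + 8) ∧
    racahSum (t + 4) 4 3 3 =
      8 * (t + 3) * (t + 2) ^ 2 * (t + 1) * (2 * t + 5) / ((3 * t + 8) * (3 * t + 7)) ∧
    racahSum (t + 4) 4 4 3 =
      -8 * (t + 4) * (t + 3) * (t + 2) ^ 2 * (t + 1) / ((3 * t + 8) * (3 * t + 7)) := by
  have hx : (0 : ℝ) ≤ t := Nat.cast_nonneg t
  refine ⟨?_, ?_, ?_, ?_, ?_⟩
  all_goals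
    rw [racahSum_four t (by norm_num)]
    generalize (t : ℝ) = x at *
    have c6 : x + 3 ≠ 0 := by positivity
    have c10 : 3 * x + 8 ≠ 0 := by positivity
    have c11 : 3 * x + 7 ≠ 0 := by positivity
    have r1 : 3 * x + 9 - 1 = 3 * x + 8 := by ring
    have r2 : 3 * x + 9 - 2 = 3 * x + 7 := by ring
    have r0 : 3 * x + 9 = 3 * (x + 3) := by ring
    simp [sum_range_succ, prod_range_succ, r1, r2]
    try rw [r0]
    try field_simp
    ring

/-- The weight at `l = 1` is omitted because `racahSum_four_three` has a zero there. -/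
lemma colWeight_eq {x : ℝ} (hx : 0 ≤ x) :
    colWeight x 0 = (x + 1) * (x + 2) / (96 * (2 * x + 7) * (2 * x + 5)) ∧
    colWeight x 2 = 3 * (x + 3) * (3 * x + 8) * (x + 4) /
      (16 * (2 * x + 7) * (x + 2) * (2 * x + 3)) ∧
    colWeight x 3 = (3 * x + 8) * (3 * x + 7) * (x + 4) /
      (16 * (2 * x + 5) * (x + 2) * (x + 1)) ∧
    colWeight x 4 = 3 * (x + 3) * (3 * x + 8) * (3 * x + 7) /
      (32 * (2 * x + 5) * (2 * x + 3) * (x + 1)) := by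
  refine ⟨?_, ?_, ?_, ?_⟩
  all_goals
    rw [colWeight, div_eq_div_iff]
    · simp [prod_range_succ, Nat.factorial]
      ring
    · refine mul_ne_zero (by positivity) (prod_ne_zero_iff.2 fun i hi => ?_)
      have : (i : ℝ) ≤ 4 := by exact_mod_cast Nat.lt_succ_iff.1 (mem_range.1 hi)
      have : 0 < 2 * x + 9 - (4 : ℝ) - i := by linarith
      push_cast
      linarith
    · positivity

lemma sum_colWeight_mul (t k : ℕ) (hk : k ≤ 4) (h3 : k ≠ 3) :
    ∑ l ∈ range 5, colWeight t l * racahSum (t + 4) 4 l k * racahSum (t + 4) 4 l 3 = 0 := by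
  have hx : (0 : ℝ) ≤ t := Nat.cast_nonneg t
  obtain ⟨v0, v1, v2, v3, v4⟩ := racahSum_four_three t
  obtain ⟨w0, w2, w3, w4⟩ := colWeight_eq hx
  simp only [sum_range_succ, range_zero, sum_empty, v0, v1, v2, v3, v4, w0, w2, w3, w4]
  rw [racahSum_four t (show 0 ≤ 4 by norm_num), racahSum_four t (show 2 ≤ 4 by norm_num),
    racahSum_four t (show 3 ≤ 4 by norm_num), racahSum_four t (show 4 ≤ 4 by norm_num)]
  generalize (t : ℝ) = x at *
  have c8 : x + 3 ≠ 0 := by positivity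
  have r0 : 3 * x + 9 = 3 * (x + 3) := by ring
  have r1 : 3 * (x + 3) - 1 = 3 * x + 8 := by ring
  have r2 : 3 * (x + 3) - 2 = 3 * x + 7 := by ring
  have r3 : 3 * (x + 3) - 3 = 3 * (x + 2) := by ring
  interval_cases k
  · simp
    field_simp
    ring
  · simp [sum_range_succ, r0]
    field_simp
    ring
  · simp [sum_range_succ, prod_range_succ, r0, r1]
    field_simp
    ring
  · exact absurd rfl h3
  · simp [sum_range_succ, prod_range_succ, r0, r1, r2, r3, show Nat.choose 4 2 = 6 from rfl]
    field_simp
    ring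

lemma sum_colWeight_mul_self (t : ℕ) :
    colWeight t 3 *
      ∑ l ∈ range 5, colWeight t l * racahSum (t + 4) 4 l 3 * racahSum (t + 4) 4 l 3 =
      (((t : ℝ) + 4) * (t + 3) * (t + 2)) ^ 2 := by
  have hx : (0 : ℝ) ≤ t := Nat.cast_nonneg t
  obtain ⟨v0, v1, v2, v3, v4⟩ := racahSum_four_three t
  obtain ⟨w0, w2, w3, w4⟩ := colWeight_eq hx
  simp only [sum_range_succ, range_zero, sum_empty, v0, v1, v2, v3, v4, w0, w2, w3, w4]
  generalize (t : ℝ) = x at *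
  field_simp
  ring

/-- `A² e₃ = e₃` for `n = 4`. -/
lemma matA_four_sum (t : ℕ) (k : Fin 5) :
    ∑ l, matA (t + 4) 4 k l * matA (t + 4) 4 l 3 = if k = 3 then 1 else 0 := by
  have hN : 4 ≤ t + 4 := by omega
  have hk : (k : ℕ) ≤ 4 := Nat.lt_succ_iff.1 k.2
  have key : ∑ l, matA (t + 4) 4 k l * matA (t + 4) 4 l 3 =
      rowCoeff (t + 4) 4 k * rowCoeff (t + 4) 4 3 *
        (((3 * t + 9).factorial : ℝ) / ((t + 4).factorial : ℝ)) *
        ∑ l ∈ range 5, colWeight t l * racahSum (t + 4) 4 l k * racahSum (t + 4) 4 l 3 := by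
    rw [← Fin.sum_univ_eq_sum_range
      (fun l => colWeight t l * racahSum (t + 4) 4 l k * racahSum (t + 4) 4 l 3), mul_sum]
    refine sum_congr rfl fun l _ => ?_
    have hl := colCoeff_sq_four t (Nat.lt_succ_iff.1 l.2)
    rw [matA_symm _ _ l 3, matA_apply hN, matA_apply hN]
    change rowCoeff (t + 4) 4 k * _ * _ * (rowCoeff (t + 4) 4 3 * _ * racahSum (t + 4) 4 l 3) = _
    linear_combination (rowCoeff (t + 4) 4 k * rowCoeff (t + 4) 4 3 * racahSum (t + 4) 4 l k *
      racahSum (t + 4) 4 l 3) * hl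
  rw [key]
  split_ifs with h
  · subst h
    -- The row factor is a multiple of the column factor, whose square is known.
    have hr : rowCoeff (t + 4) 4 3 = colCoeff (t + 4) 4 3 * ((t + 1).factorial : ℝ) /
        ((3 * t + 9).factorial : ℝ) := by
      have h1 : 3 * (t + 4) - 4 + 1 = 3 * t + 9 := by omega
      have h2 : t + 4 - 3 = t + 1 := by omega
      have hf : ((3 * t + 9).factorial : ℝ) ≠ 0 := by exact_mod_cast Nat.factorial_ne_zero _
      rw [rowCoeff, colCoeff, h1, h2]
      simp only [Nat.reduceSub, Nat.factorial_one]
      push_cast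
      field_simp
    have hs := colCoeff_sq_four t (show 3 ≤ 4 by norm_num)
    have hm := sum_colWeight_mul_self t
    have hfac : ((t + 4).factorial : ℝ) =
        (t + 4) * (t + 3) * (t + 2) * ((t + 1).factorial : ℝ) := by
      rw [Nat.factorial_succ (t + 3), Nat.factorial_succ (t + 2), Nat.factorial_succ (t + 1)]
      push_cast
      ring
    change rowCoeff (t + 4) 4 3 * rowCoeff (t + 4) 4 3 * _ *
      (∑ l ∈ range 5, colWeight t l * racahSum (t + 4) 4 l 3 * racahSum (t + 4) 4 l 3) = 1
    have hf : ((3 * t + 9).factorial : ℝ) ≠ 0 := by exact_mod_cast Nat.factorial_ne_zero _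
    have hf' : ((t + 1).factorial : ℝ) ≠ 0 := by exact_mod_cast Nat.factorial_ne_zero _
    have ht : (0 : ℝ) ≤ t := Nat.cast_nonneg t
    generalize (∑ l ∈ range 5, colWeight t l * racahSum (t + 4) 4 l 3 * racahSum (t + 4) 4 l 3)
      = S at *
    rw [hr]
    calc _ = colCoeff (t + 4) 4 3 ^ 2 * (((t + 1).factorial : ℝ) / ((3 * t + 9).factorial : ℝ)) ^ 2
          * (((3 * t + 9).factorial : ℝ) / ((t + 4).factorial : ℝ)) * S := by ring
      _ = colWeight t 3 * S * (((t + 1).factorial : ℝ) / ((t + 4).factorial : ℝ)) ^ 2 := by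
          rw [hs]; field_simp
      _ = 1 := by
          rw [hm, hfac]; field_simp
  · rw [sum_colWeight_mul t k hk (fun h' => h (Fin.ext h')), mul_zero]

/-! ### The entries of `G`, `H` and `H̃` -/

lemma matPi_eq (n : ℕ) (m : Fin (n + 1)) :
    matPi m n = vecMulVec (Pi.single m 1) (Pi.single m 1) := by
  ext k l
  simp only [matPi, Matrix.of_apply, vecMulVec_apply, Pi.single_apply, Fin.ext_iff]
  split_ifs <;> simp_all

lemma matPihat_eq (N n : ℕ) (m : Fin (n + 1)) :
    matPihat N m n = vecMulVec ((matA N n).col m) ((matA N n).col m) := by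
  have : (matA N n).row m = (matA N n).col m := by
    ext k; exact matA_symm N n m k
  rw [matPihat, matPi_eq, mul_vecMulVec, vecMulVec_mul, mulVec_single_one, single_one_vecMul, this]

lemma matDhat_symm (N n : ℕ) : (matDhat N n)ᵀ = matDhat N n := by
  have : (matA N n)ᵀ = matA N n := by ext k l; exact matA_symm N n l k
  rw [matDhat, transpose_mul, transpose_mul, this, matD, diagonal_transpose, Matrix.mul_assoc]

lemma matH_apply_of_ne (N n : ℕ) {m k l : Fin (n + 1)} (hk : k ≠ m) :
    matH N m n k l = -((-1) ^ (k : ℕ) * (matA N n k m * matA N n l m)) := by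
  rw [matH, matPihat_eq, matPi_eq, matD, Matrix.sub_apply, diagonal_mul, vecMulVec_mul]
  simp [vecMulVec_apply, hk]

lemma matHtilde_eq_transpose (N n : ℕ) (m : Fin (n + 1)) :
    matHtilde N m n = (matH N m n)ᵀ := by
  rw [matHtilde, matH, transpose_sub, transpose_mul, transpose_mul, matDhat_symm, matPihat_eq,
    matPi_eq, transpose_vecMulVec, transpose_vecMulVec, matD, diagonal_transpose]

lemma matHtilde_apply_of_ne (N n : ℕ) {m k l : Fin (n + 1)} (hl : l ≠ m) :
    matHtilde N m n k l = -((-1) ^ (l : ℕ) * (matA N n k m * matA N n l m)) := by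
  rw [matHtilde_eq_transpose, transpose_apply, matH_apply_of_ne N n hl]
  ring

lemma matG_apply_of_ne (N n : ℕ) {m k l : Fin (n + 1)} (hk : k ≠ m) :
    matG N m n k l = -(matA N n k m * matA N n l m) := by
  rw [matG, matPihat_eq, matPi_eq, Matrix.sub_apply]
  simp [vecMulVec_apply, hk]

/-! ### The exceptional case and its uniqueness -/

lemma matH_three_four {N : ℕ} (hN : 4 ≤ N) : matH N 3 4 = matG N 3 4 := by
  obtain ⟨t, rfl⟩ := Nat.exists_eq_add_of_le' hN
  set A := matA (t + 4) 4 with hA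
  set e : Fin 5 → ℝ := Pi.single 3 1 with he
  set v : Fin 5 → ℝ := A.col 3 with hv
  have hAv : A *ᵥ v = e := by
    ext k
    simp only [he, Pi.single_apply]
    exact matA_four_sum t k
  have hv1 : v 1 = 0 := (matA_eq_zero_iff hN 1 3).2 (by
    have h := racahSum_one (show 3 ≤ 4 by norm_num) hN
    have hne : 3 * ((t + 4 : ℕ) : ℝ) - (4 : ℕ) + 1 ≠ 0 := by
      push_cast
      have : (0 : ℝ) ≤ t := Nat.cast_nonneg t
      linarith
    refine (mul_eq_zero.1 (h.trans ?_)).resolve_left hne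
    push_cast
    ring)
  have hDv : matD 4 *ᵥ v = v - (2 * v 3) • e := by
    ext k
    rw [matD, mulVec_diagonal]
    fin_cases k <;> simp [he, hv1] <;> ring
  have hw : A *ᵥ (matD 4 *ᵥ v) = e - (2 * v 3) • v := by
    rw [hDv, mulVec_sub, mulVec_smul, hAv, he, mulVec_single_one]
  have hDhat : matDhat (t + 4) 4 *ᵥ e = e - (2 * v 3) • v := by
    rw [matDhat, ← mulVec_mulVec, ← mulVec_mulVec, he, mulVec_single_one]
    exact hw
  have hpi := matPi_eq 4 3
  have hph := matPihat_eq (t + 4) 4 3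
  change matPi 3 4 = vecMulVec e e at hpi
  change matPihat (t + 4) 3 4 = vecMulVec v v at hph
  rw [matH, matG, hpi, hph, vecMulVec_mul, mul_vecMulVec, ← mulVec_transpose, matDhat_symm, hDhat,
    hDv]
  ext k l
  simp [vecMulVec_apply]
  ring

lemma matHtilde_three_four {N : ℕ} (hN : 4 ≤ N) : matHtilde N 3 4 = matH N 3 4 := by
  have hpi : (matPi 3 4)ᵀ = matPi 3 4 := by
    have := matPi_eq 4 3
    change matPi 3 4 = _ at this
    rw [this, transpose_vecMulVec]
  have hph : (matPihat N 3 4)ᵀ = matPihat N 3 4 := by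
    have := matPihat_eq N 4 3
    change matPihat N 3 4 = _ at this
    rw [this, transpose_vecMulVec]
  have ht : matHtilde N 3 4 = (matH N 3 4)ᵀ := matHtilde_eq_transpose N 4 3
  rw [ht, matH_three_four hN, matG, transpose_sub, hpi, hph]

lemma matH_add_matHtilde_three_four {N : ℕ} (hN : 4 ≤ N) :
    matH N 3 4 + matHtilde N 3 4 = (2 : ℝ) • matG N 3 4 := by
  rw [matHtilde_three_four hN, matH_three_four hN, two_smul]

/-- The common consequence of `H̃ = H` and of `H + H̃ = β G`, read off in row `0`, already forces
the exceptional case. -/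
lemma eq_three_four_of_mul_eq_zero {N n : ℕ} (hn : n ≤ N) (m : Fin (n + 1)) (h2 : 2 ≤ (m : ℕ))
    (h : ∀ k : Fin (n + 1), Odd (k : ℕ) → k ≠ m → matA N n 0 m * matA N n k m = 0) :
    (m : ℕ) = 3 ∧ n = 4 := by
  have hm : (m : ℕ) ≤ n := Nat.lt_succ_iff.1 m.2
  have hz : ∀ k, k ≤ n → Odd k → k ≠ m → racahSum N n m k = 0 := by
    intro k hk hodd hne
    obtain ⟨i, hi⟩ : ∃ i : Fin (n + 1), (i : ℕ) = k := ⟨⟨k, Nat.lt_succ_iff.2 hk⟩, rfl⟩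
    subst hi
    have hi0 := h i hodd fun e => hne (congrArg Fin.val e)
    exact (matA_eq_zero_iff hn i m).1 ((mul_eq_zero.1 hi0).resolve_left (matA_zero_ne_zero hn m))
  exact level_eq_four h2 hm hn (hz 1 (by omega) odd_one (by omega))
    fun h3 hm3 => hz 3 h3 (by decide) (Ne.symm hm3)

end ReducedYB

/-- Here `N = 2s` is the doubled spin. -/
theorem lemma5 :
    (∀ N m n : ℕ, 2 ≤ m → m ≤ n → n ≤ N →
      ((ReducedYB.matHtilde N m n = ReducedYB.matH N m n ↔ m = 3 ∧ n = 4) ∧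
        ((∃ β : ℝ, ReducedYB.matH N m n + ReducedYB.matHtilde N m n = β • ReducedYB.matG N m n) ↔
          m = 3 ∧ n = 4))) ∧
    (∀ N : ℕ, 4 ≤ N →
      ReducedYB.matH N 3 4 + ReducedYB.matHtilde N 3 4 = (2 : ℝ) • ReducedYB.matG N 3 4) := by
  open ReducedYB in
  refine ⟨fun N m n h2 hmn hn => ⟨⟨fun h => ?_, ?_⟩, ⟨?_, ?_⟩⟩,
    fun N hN => matH_add_matHtilde_three_four hN⟩
  · lift m to Fin (n + 1) using Nat.lt_succ_iff.2 hmn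
    have h0 : (0 : Fin (n + 1)) ≠ m := fun e => by simp [← e] at h2
    refine eq_three_four_of_mul_eq_zero hn m h2 fun k hk hkm => ?_
    have := congrFun (congrFun h 0) k
    rw [matHtilde_apply_of_ne N n hkm, matH_apply_of_ne N n h0, hk.neg_one_pow] at this
    simp only [Fin.val_zero, pow_zero] at this
    linarith
  · rintro ⟨rfl, rfl⟩
    exact matHtilde_three_four hn
  · rintro ⟨β, h⟩
    lift m to Fin (n + 1) using Nat.lt_succ_iff.2 hmn
    have h0 : (0 : Fin (n + 1)) ≠ m := fun e => by simp [← e] at h2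
    have entry : ∀ k : Fin (n + 1), k ≠ m →
        (1 + (-1) ^ (k : ℕ) - β) * (matA N n 0 m * matA N n k m) = 0 := by
      intro k hkm
      have := congrFun (congrFun h 0) k
      rw [Matrix.add_apply, Matrix.smul_apply, matHtilde_apply_of_ne N n hkm,
        matH_apply_of_ne N n h0, matG_apply_of_ne N n h0, smul_eq_mul] at this
      simp only [Fin.val_zero, pow_zero] at this
      linear_combination -this
    -- The entry `(0, 0)` determines `β`, since `A_{0m} ≠ 0`.
    have hβ : β = 2 := by
      have := (mul_eq_zero.1 (entry 0 h0)).resolve_right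
        (mul_ne_zero (matA_zero_ne_zero hn m) (matA_zero_ne_zero hn m))
      simp only [Fin.val_zero, pow_zero] at this
      linarith
    refine eq_three_four_of_mul_eq_zero hn m h2 fun k hk hkm => ?_
    have := entry k hkm
    rw [hβ, hk.neg_one_pow] at this
    linarith
  · rintro ⟨rfl, rfl⟩
    exact ⟨2, matH_add_matHtilde_three_four hn⟩
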